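/- For a topological space $X$, let $\mathcal{O}$ be the collection of all open covers of $X$, and let $\mathcal{O}_{\sf kfd}$ be the collection of those open covers $\mathcal{U}$ of $X$ such that every compact subset of $X$ of finite (Lebesgue covering) dimension is contained in some member of $\mathcal{U}$ (the case $X\in\mathcal{U}$ is allowed). For an ordinal $\alpha$, the game ${\sf G}_1^{\alpha}(\mathcal{O}_{\sf kfd},\mathcal{O})$ on $X$ has one inning for each $\gamma<\alpha$: in inning $\gamma$ player ONE chooses $A_\gamma\in\mathcal{O}_{\sf kfd}$ and then player TWO chooses $B_\gamma\in A_\gamma$; TWO wins the play if $\{B_\gamma:\gamma<\alpha\}\in\mathcal{O}$. For nonempty $X$, let ${\sf tp}_{{\sf S}_1(\mathcal{O}_{\sf kfd},\mathcal{O})}(X)$ be the least ordinal $\alpha$ such that TWO has a winning strategy in the game ${\sf G}_1^{1+\alpha}(\mathcal{O}_{\sf kfd},\mathcal{O})$ on $X$, and put ${\sf tp}_{{\sf S}_1(\mathcal{O}_{\sf kfd},\mathcal{O})}(\emptyset)=-1$; thus the value is $0$ for nonempty compact finite dimensional spaces. Let ${\sf S}_\omega$ be Smirnov's compactum, the one-point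 compactification of the topological sum $\bigoplus_{k=1}^{\infty}{\mathbb I}^k$ of the cubes ${\mathbb I}^k$, ${\mathbb I}=[0,1]$. Then for every positive integer $n$, $${\sf tp}_{{\sf S}_1(\mathcal{O}_{\sf kfd},\mathcal{O})}({\sf S}_\omega^n)=n.$$ Equivalently, the least ordinal $\alpha$ for which TWO has a winning strategy in ${\sf G}_1^{\alpha}(\mathcal{O}_{\sf kfd},\mathcal{O})$ on ${\sf S}_\omega^n$ is $n+1$. -/

import Mathlib

open Set

/-- The (Lebesgue) covering dimension of `X` is at most `d`: every finite open cover of `X` has a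
finite open refinement covering `X` such that each point lies in at most `d + 1` of its members. -/
def CoveringDimLE (X : Type*) [TopologicalSpace X] (d : ℕ) : Prop :=
  ∀ U : Set (Set X), U.Finite → (∀ u ∈ U, IsOpen u) → ⋃₀ U = univ →
    ∃ V : Set (Set X), V.Finite ∧ (∀ v ∈ V, IsOpen v) ∧ ⋃₀ V = univ ∧
      (∀ v ∈ V, ∃ u ∈ U, v ⊆ u) ∧
      ∀ x : X, {v ∈ V | x ∈ v}.encard ≤ d + 1

/-- `X` is finite dimensional. -/
def FiniteDimensionalSpace (X : Type*) [TopologicalSpace X] : Prop :=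
  ∃ d : ℕ, CoveringDimLE X d

/-- The family `O(T)` of all `T`-covers of `X`: the open covers of `X` such that each element of
`T` is contained in a single member of the cover. -/
def TCovers {X : Type*} [TopologicalSpace X] (T : Set (Set X)) : Set (Set (Set X)) :=
  {U | (∀ u ∈ U, IsOpen u) ∧ ⋃₀ U = univ ∧ ∀ t ∈ T, ∃ u ∈ U, t ⊆ u}

/-- `O`: the `T`-covers for `T` the family of one-element subsets, i.e. the open covers. -/
def OCovers (X : Type*) [TopologicalSpace X] : Set (Set (Set X)) :=
  TCovers {t : Set X | ∃ x, t = {x}}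

/-- `O_kfd`: the `T`-covers for `T` the family of compact finite dimensional subsets. -/
def OkfdCovers (X : Type*) [TopologicalSpace X] : Set (Set (Set X)) :=
  TCovers {C : Set X | IsCompact C ∧ FiniteDimensionalSpace C}

/-- TWO has a winning strategy in the game `G_1^α(𝒜, ℬ)`. There is one inning for each `γ < α`;
in inning `γ` player ONE picks `A γ ∈ 𝒜`, and TWO answers with an element of `A γ`. TWO wins if the
set of all answers belongs to `ℬ`. A strategy `F` computes the answer in inning `γ` from ONE's moves
`A ξ`, `ξ ≤ γ`. (The values of `A` at ordinals `≥ α` play no role.) -/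
def TwoHasWinningStrategy {X : Type*} (𝒜 ℬ : Set (Set (Set X))) (α : Ordinal.{0}) : Prop :=
  ∃ F : (γ : Ordinal.{0}) → (Iic γ → Set (Set X)) → Set X,
    ∀ A : Ordinal.{0} → Set (Set X), (∀ γ < α, A γ ∈ 𝒜) →
      (∀ γ < α, F γ (fun ξ => A ξ) ∈ A γ) ∧
      {B : Set X | ∃ γ < α, B = F γ (fun ξ => A ξ)} ∈ ℬ

open Classical in
/-- The ordinal `tp_{S_1(𝒜, ℬ)}(X)`, in the normalization in which `tp = -1` (here `⊥`) for the
empty space, and a nonempty space on which TWO can win in a single inning has `tp = 0`: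
for nonempty `X`, it is the least `α` such that TWO has a winning strategy in the game with
`1 + α` innings. (For infinite `α` one has `1 + α = α`.) -/
noncomputable def tp {X : Type*} (𝒜 ℬ : Set (Set (Set X))) : WithBot Ordinal.{0} :=
  if IsEmpty X then ⊥
  else ((sInf {α | TwoHasWinningStrategy 𝒜 ℬ (1 + α)} : Ordinal.{0}) : WithBot Ordinal.{0})

/-- Smirnov's compactum: the one-point compactification of the topological sum of the cubes `I^k`,
`k = 1, 2, 3, …`. -/
abbrev SmirnovCompactum : Type :=
  OnePoint (Σ k : ℕ+, (Fin (k : ℕ) → unitInterval))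

/-! Upper bound: TWO keeps integers `0 = b 0 ≤ b 1 ≤ ...` and in inning `j` answers with a set
containing `core n (b j)`, which is compact and finite dimensional. By compactness the answer
contains `avoiding n (b j) (b (j + 1))` for some `b (j + 1)`. A point missed in all of `n + 1`
innings would have a coordinate in each of `n + 1` disjoint ranges of cube dimensions, but it has
only `n` coordinates (`exists_forall_mem_avoiding`).

Lower bound: ONE spends one factor per inning and keeps the uncovered part `Thick`. A compact set
`C` of dimension at most `d` cannot meet every intersection of `d + 1` partitions between opposite
faces of `I^(d+1)`: the coordinate functions can be perturbed to have no common zero on `C`. Hence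
the open sets missing a thicker part of the current set form a legal move (`Thick.exists_disjoint`,
`thickCover_mem`). Thick sets are nonempty by the Poincaré–Miranda theorem on a product of cubes, so
`n` innings do not suffice. That theorem is derived from a mod `2` cubical Sperner lemma. -/

/-! ### Mod 2 cubical cochains and a Sperner lemma. -/

section CubicalCochains

variable {ι : Type*} [DecidableEq ι]

/-- The vertex of the unit lattice cube corresponding to a set of directions. -/
def cubeVertex (S : Finset ι) : ι → ℕ := fun i => if i ∈ S then 1 else 0

/-- The mod `2` cubical coboundary: `ω S v` is the value of the cochain `ω` on the face with
least vertex `v` and directions `S`. -/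
def coboundary (ω : Finset ι → (ι → ℕ) → ZMod 2) (S : Finset ι) (v : ι → ℕ) : ZMod 2 :=
  ∑ a ∈ S, (ω (S.erase a) (v + cubeVertex {a}) + ω (S.erase a) v)

/-- The cup product of the coboundaries of the `0`-cochains `s 0, …, s (k - 1)`. -/
def cupProduct (s : ℕ → (ι → ℕ) → ZMod 2) : ℕ → Finset ι → (ι → ℕ) → ZMod 2
  | 0, _, _ => 1
  | k + 1, S, v => ∑ a ∈ S, cupProduct s k (S.erase a) v *
      (s k (v + cubeVertex S) + s k (v + cubeVertex (S.erase a)))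

theorem cubeVertex_singleton_add {S : Finset ι} {a : ι} (ha : a ∈ S) :
    cubeVertex {a} + cubeVertex (S.erase a) = cubeVertex S := by
  ext i
  by_cases h : i = a
  · subst h; simp [cubeVertex, ha]
  · simp [cubeVertex, h]

/-- Removing two directions in either order gives the same four terms, so they cancel in pairs mod
`2`. -/
theorem coboundary_coboundary (ω : Finset ι → (ι → ℕ) → ZMod 2) (S : Finset ι) (v : ι → ℕ) :
    coboundary (coboundary ω) S v = 0 := by
  have key : coboundary (coboundary ω) S v = ∑ p ∈ S.offDiag,
      (ω ((S.erase p.1).erase p.2) (v + cubeVertex {p.1} + cubeVertex {p.2}) +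
        ω ((S.erase p.1).erase p.2) (v + cubeVertex {p.1}) +
        (ω ((S.erase p.1).erase p.2) (v + cubeVertex {p.2}) +
          ω ((S.erase p.1).erase p.2) v)) := by
    rw [Finset.sum_finset_product' S.offDiag S (fun a => S.erase a)
      (f := fun a b => (ω ((S.erase a).erase b) (v + cubeVertex {a} + cubeVertex {b}) +
        ω ((S.erase a).erase b) (v + cubeVertex {a}) +
        (ω ((S.erase a).erase b) (v + cubeVertex {b}) + ω ((S.erase a).erase b) v)))]
    · simp only [coboundary, ← Finset.sum_add_distrib]
    · rintro ⟨a, b⟩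
      simp only [Finset.mem_offDiag, Finset.mem_erase]
      tauto
  rw [key]
  refine Finset.sum_involution (fun p _ => p.swap) ?_ ?_ ?_ ?_
  · rintro ⟨a, b⟩ -
    simp only [Prod.fst_swap, Prod.snd_swap]
    rw [Finset.erase_right_comm (a := b), add_right_comm v (cubeVertex {b})]
    generalize ω ((S.erase a).erase b) (v + cubeVertex {a} + cubeVertex {b}) = x
    generalize ω ((S.erase a).erase b) (v + cubeVertex {a}) = y
    generalize ω ((S.erase a).erase b) (v + cubeVertex {b}) = z
    generalize ω ((S.erase a).erase b) v = w
    have h2 : (2 : ZMod 2) = 0 := rfl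
    linear_combination (x + y + z + w) * h2
  · rintro ⟨a, b⟩ h - h'
    simp only [Finset.mem_offDiag] at h
    exact h.2.2 (congrArg Prod.snd h')
  · rintro ⟨a, b⟩ h
    simp only [Finset.mem_offDiag, Prod.swap_prod_mk] at h ⊢
    exact ⟨h.2.1, h.1, fun e => h.2.2 e.symm⟩
  · rintro ⟨a, b⟩ -
    rfl

/-- Leibniz rule for a cocycle `ω`: `ω ∪ δf = δ(ω ∪ f)`. -/
theorem sum_mul_add_eq_coboundary {ω : Finset ι → (ι → ℕ) → ZMod 2}
    (hω : ∀ S v, coboundary ω S v = 0) (f : (ι → ℕ) → ZMod 2) (S : Finset ι) (v : ι → ℕ) :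
    ∑ a ∈ S, ω (S.erase a) v * (f (v + cubeVertex S) + f (v + cubeVertex (S.erase a))) =
      coboundary (fun T w => ω T w * f (w + cubeVertex T)) S v := by
  have h1 : coboundary (fun T w => ω T w * f (w + cubeVertex T)) S v =
      ∑ a ∈ S, (ω (S.erase a) (v + cubeVertex {a}) * f (v + cubeVertex S) +
        ω (S.erase a) v * f (v + cubeVertex (S.erase a))) := by
    refine Finset.sum_congr rfl fun a ha => ?_
    beta_reduce
    rw [add_assoc, cubeVertex_singleton_add ha]
  have h2 : ∑ a ∈ S, ω (S.erase a) (v + cubeVertex {a}) = ∑ a ∈ S, ω (S.erase a) v := by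
    have := hω S v
    rw [coboundary, Finset.sum_add_distrib, CharTwo.add_eq_zero] at this
    exact this
  rw [h1, Finset.sum_add_distrib, ← Finset.sum_mul, h2, Finset.sum_mul, ← Finset.sum_add_distrib]
  exact Finset.sum_congr rfl fun a _ => by ring

theorem coboundary_cupProduct (s : ℕ → (ι → ℕ) → ZMod 2) (k : ℕ) (S : Finset ι) (v : ι → ℕ) :
    coboundary (cupProduct s k) S v = 0 := by
  induction k generalizing S v with
  | zero => exact Finset.sum_eq_zero fun a _ => CharTwo.add_self_eq_zero _
  | succ k ih =>
    have : cupProduct s (k + 1) =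
        coboundary (fun T w => cupProduct s k T w * s k (w + cubeVertex T)) := by
      funext S v
      exact sum_mul_add_eq_coboundary ih (s k) S v
    rw [this]
    exact coboundary_coboundary _ S v

theorem cupProduct_succ (s : ℕ → (ι → ℕ) → ZMod 2) (k : ℕ) (S : Finset ι) (v : ι → ℕ) :
    cupProduct s (k + 1) S v =
      coboundary (fun T w => cupProduct s k T w * s k (w + cubeVertex T)) S v :=
  sum_mul_add_eq_coboundary (coboundary_cupProduct s k) (s k) S v

/-- The factor `δ(s i)` vanishes on a cube on whose vertices `s i` is constant. -/
theorem cupProduct_eq_zero {s : ℕ → (ι → ℕ) → ZMod 2} {i k : ℕ} (hi : i < k) {S : Finset ι}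
    {v : ι → ℕ} {c : ZMod 2} (h : ∀ T ⊆ S, s i (v + cubeVertex T) = c) :
    cupProduct s k S v = 0 := by
  induction k generalizing S with
  | zero => omega
  | succ k ih =>
    refine Finset.sum_eq_zero fun a _ => ?_
    rcases Nat.lt_succ_iff_lt_or_eq.1 hi with hik | rfl
    · rw [ih hik fun T hT => h T (hT.trans (Finset.erase_subset _ _)), zero_mul]
    · rw [h _ subset_rfl, h _ (Finset.erase_subset _ _), CharTwo.add_self_eq_zero, mul_zero]

theorem sum_piFinset_eq_sum_update [Fintype ι] {M : Type*} [AddCommMonoid M]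
    (t : ι → Finset ℕ) (a : ι) (F : (ι → ℕ) → M) :
    ∑ v ∈ Fintype.piFinset t, F v =
      ∑ v ∈ Fintype.piFinset (Function.update t a {0}), ∑ x ∈ t a, F (Function.update v a x) := by
  rw [← Finset.sum_product']
  refine Finset.sum_nbij' (fun v => (Function.update v a 0, v a))
    (fun p => Function.update p.1 a p.2) ?_ ?_ ?_ ?_ ?_
  · intro v hv
    simp only [Fintype.mem_piFinset, Finset.mem_product] at hv ⊢
    refine ⟨fun i => ?_, hv a⟩
    by_cases h : i = a
    · subst h; simp
    · simpa [h] using hv i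
  · rintro ⟨v, x⟩ hv
    simp only [Fintype.mem_piFinset, Finset.mem_product] at hv ⊢
    intro i
    by_cases h : i = a
    · subst h; simpa using hv.2
    · simpa [h] using hv.1 i
  · intro v _
    simp
  · rintro ⟨v, x⟩ hv
    simp only [Fintype.mem_piFinset, Finset.mem_product] at hv
    have := hv.1 a
    simp only [Function.update_self, Finset.mem_singleton] at this
    simp [← this]
  · intro v _
    simp

theorem sum_piFinset_telescope [Fintype ι] {m : ℕ} {t : ι → Finset ℕ} {a : ι}
    (ha : t a = Finset.range m) (F : (ι → ℕ) → ZMod 2) :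
    ∑ v ∈ Fintype.piFinset t, (F (v + cubeVertex {a}) + F v) =
      ∑ v ∈ Fintype.piFinset (Function.update t a {0}),
        (F (Function.update v a m) + F (Function.update v a 0)) := by
  rw [sum_piFinset_eq_sum_update t a, ha]
  refine Finset.sum_congr rfl fun v _ => ?_
  rw [← CharTwo.sub_eq_add, ← Finset.sum_range_sub fun x => F (Function.update v a x)]
  refine Finset.sum_congr rfl fun x _ => ?_
  rw [CharTwo.sub_eq_add]
  congr 2
  ext i
  by_cases h : i = a
  · subst h; simp [cubeVertex]
  · simp [cubeVertex, h]

/-- A cubical Sperner lemma: on the grid `{0, …, m}^N`, the cup product of the coboundaries of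
`N` two-valued functions that separate the opposite faces has total mass `1` mod `2`. -/
theorem sum_cupProduct_eq_one {N m : ℕ} {s : ℕ → (Fin N → ℕ) → ZMod 2}
    (h0 : ∀ (i : Fin N) v, v i = 0 → s i v = 0) (hm : ∀ (i : Fin N) v, v i = m → s i v = 1)
    {k : ℕ} (hk : k ≤ N) :
    ∑ v ∈ Fintype.piFinset (fun i : Fin N => if i.val < k then Finset.range m else {m}),
      cupProduct s k {i | i.val < k} v = 1 := by
  induction k with
  | zero =>
    have : Fintype.piFinset (fun i : Fin N => if i.val < 0 then Finset.range m else {m}) =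
        {fun _ => m} := by
      ext v
      simp [funext_iff]
    rw [this]
    simp [cupProduct]
  | succ k ih =>
    set a : Fin N := ⟨k, hk⟩ with ha
    set S : Finset (Fin N) := {i | i.val < k + 1} with hS
    set t : Fin N → Finset ℕ := fun i => if i.val < k + 1 then Finset.range m else {m} with ht
    have haS : a ∈ S := by simp [hS, ha]
    have hSa : S.erase a = ({i | i.val < k} : Finset (Fin N)) := by
      ext i
      simp only [hS, ha, Finset.mem_erase, Finset.mem_filter, Finset.mem_univ, true_and, ne_eq,
        Fin.ext_iff]
      omega
    simp_rw [cupProduct_succ, coboundary]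
    rw [Finset.sum_comm]
    -- Discrete Stokes: only the end faces in each direction `b` remain. For `b ≠ a`, `s b` is
    -- constant on each end face, so the product of the first `k` factors vanishes there. For `b =
    -- a`, `s k` is `0` on one face and `1` on the other, which leaves the sum of the induction
    -- hypothesis.
    have hface : ∀ b ∈ S, ∑ v ∈ Fintype.piFinset t,
        (cupProduct s k (S.erase b) (v + cubeVertex {b}) *
            s k (v + cubeVertex {b} + cubeVertex (S.erase b)) +
          cupProduct s k (S.erase b) v * s k (v + cubeVertex (S.erase b))) =
        if b = a then 1 else 0 := by
      intro b hb
      have hb' : b.val < k + 1 := by simpa [hS] using hb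
      rw [sum_piFinset_telescope (a := b) (m := m) (if_pos hb')
        (fun w => cupProduct s k (S.erase b) w * s k (w + cubeVertex (S.erase b)))]
      split_ifs with hba
      · subst hba
        have ih' := ih (by omega)
        rw [sum_piFinset_eq_sum_update _ a] at ih'
        rw [← ih']
        refine Finset.sum_congr ?_ fun v _ => ?_
        · congr 1
          ext i : 1
          by_cases h : i = a
          · subst h; simp
          · have : i.val ≠ k := fun e => h (Fin.ext e)
            have : i.val ≤ k ↔ i.val < k := by omega
            simp [h, ht, this]
        · rw [hSa, hm a _ (by simp [cubeVertex, ha]), h0 a _ (by simp [cubeVertex, ha])]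
          simp [ha]
      · have hbk : b.val < k := by
          have : b.val ≠ k := fun e => hba (Fin.ext e)
          omega
        refine Finset.sum_eq_zero fun v _ => ?_
        have hT : ∀ T ⊆ S.erase b, b ∉ T := fun T hT hbT => Finset.notMem_erase b S (hT hbT)
        rw [cupProduct_eq_zero hbk (c := 1) fun T hT' =>
            hm b _ (by simp [cubeVertex, hT T hT']),
          cupProduct_eq_zero hbk (c := 0) fun T hT' =>
            h0 b _ (by simp [cubeVertex, hT T hT'])]
        simp
    rw [Finset.sum_congr rfl hface, Finset.sum_ite_eq' S a, if_pos haS]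

theorem exists_cube_forall_exists_ne {N m : ℕ} {s : Fin N → (Fin N → ℕ) → ZMod 2}
    (h0 : ∀ i v, v i = 0 → s i v = 0) (hm : ∀ i v, v i = m → s i v = 1) :
    ∃ v : Fin N → ℕ, ∀ i, ∃ S T, s i (v + cubeVertex S) ≠ s i (v + cubeVertex T) := by
  let s' : ℕ → (Fin N → ℕ) → ZMod 2 := fun k v => if h : k < N then s ⟨k, h⟩ v else 0
  have hs' : ∀ i : Fin N, s' i = s i := fun i => by ext v; simp [s']
  have h := sum_cupProduct_eq_one (s := s') (m := m) (k := N)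
    (fun i v hv => by rw [hs']; exact h0 i v hv) (fun i v hv => by rw [hs']; exact hm i v hv) le_rfl
  obtain ⟨v, -, hv⟩ := Finset.exists_ne_zero_of_sum_ne_zero (h.trans_ne one_ne_zero)
  refine ⟨v, fun i => ?_⟩
  by_contra! hi
  refine hv (cupProduct_eq_zero i.isLt (c := s i (v + cubeVertex ∅)) fun T _ => ?_)
  rw [hs', hi T ∅]

end CubicalCochains

/-! ### The Poincaré–Miranda theorem. -/

/-- The **Poincaré–Miranda theorem** on the cube `I^N`. -/
theorem poincare_miranda_fin {N : ℕ} {g : (Fin N → unitInterval) → Fin N → ℝ} (hg : Continuous g)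
    (h0 : ∀ x i, x i = 0 → g x i < 0) (h1 : ∀ x i, x i = 1 → 0 < g x i) : ∃ x, g x = 0 := by
  by_contra! hne
  obtain ⟨x₀, -, hx₀⟩ := isCompact_univ.exists_isMinOn (univ_nonempty (α := Fin N → unitInterval))
    hg.norm.continuousOn
  have hε : 0 < ‖g x₀‖ := norm_pos_iff.2 (hne x₀)
  obtain ⟨δ, hδ, hgδ⟩ := Metric.uniformContinuous_iff.1
    (CompactSpace.uniformContinuous_of_continuous hg) _ hε
  obtain ⟨m, hm⟩ := exists_nat_one_div_lt hδ
  -- The Sperner lemma is applied to functions on all of `ℕ^N`, so points beyond the grid are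
  -- clamped into the cube.
  let p : (Fin N → ℕ) → Fin N → unitInterval := fun v i =>
    projIcc 0 1 zero_le_one ((v i : ℝ) / (m + 1))
  have hp0 : ∀ v i, v i = 0 → p v i = 0 := fun v i hv => by
    simp [p, hv, projIcc_left]
  have hp1 : ∀ v i, v i = m + 1 → p v i = 1 := fun v i hv => by
    have : ((m : ℝ) + 1) / (m + 1) = 1 := div_self (by positivity)
    simp [p, hv, this, projIcc_right]
  obtain ⟨v, hv⟩ := exists_cube_forall_exists_ne (m := m + 1)
    (s := fun i v => if 0 < g (p v) i then 1 else 0)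
    (fun i v hv => if_neg (h0 _ _ (hp0 v i hv)).not_gt)
    (fun i v hv => if_pos (h1 _ _ (hp1 v i hv)))
  have hdist : ∀ S T, dist (p (v + cubeVertex S)) (p (v + cubeVertex T)) < δ := by
    intro S T
    refine lt_of_le_of_lt ((dist_pi_le_iff (by positivity)).2 fun i => ?_) hm
    refine le_trans (abs_projIcc_sub_projIcc (zero_le_one (α := ℝ))) ?_
    have h : |(cubeVertex S i : ℝ) - cubeVertex T i| ≤ 1 := by
      unfold cubeVertex; split_ifs <;> simp
    rw [← sub_div, abs_div, abs_of_pos (by positivity : (0 : ℝ) < m + 1)]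
    gcongr
    simpa using h
  -- Every coordinate of `g` changes sign on a cell where `g` varies by less than its minimal norm.
  have hsmall : ‖g (p v)‖ < ‖g x₀‖ := by
    have hv0 : p v = p (v + cubeVertex ∅) := by
      simp [p, cubeVertex]
    refine (pi_norm_lt_iff hε).2 fun i => ?_
    obtain ⟨S, T, hST⟩ := hv i
    have hS := hgδ (hv0 ▸ hdist ∅ S)
    have hT := hgδ (hv0 ▸ hdist ∅ T)
    replace hS := (dist_le_pi_dist _ _ i).trans_lt hS
    replace hT := (dist_le_pi_dist _ _ i).trans_lt hT
    rw [Real.dist_eq, abs_lt] at hS hT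
    rw [Real.norm_eq_abs, abs_lt, hv0]
    split_ifs at hST with hpS hpT hpT
    · exact absurd rfl hST
    · constructor <;> linarith
    · constructor <;> linarith
    · exact absurd rfl hST
  exact (hx₀ (mem_univ (p v))).not_gt hsmall

/-- The **Poincaré–Miranda theorem** for maps that differ from `x ↦ 2 x - 1` by at most `1 / 2` in
each coordinate. -/
theorem exists_eq_zero_of_abs_sub_le {ι : Type*} [Fintype ι] {g : (ι → unitInterval) → ι → ℝ}
    (hg : Continuous g) (h : ∀ x i, |g x i - (2 * (x i : ℝ) - 1)| ≤ 1 / 2) : ∃ x, g x = 0 := by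
  let e := Fintype.equivFin ι
  obtain ⟨x, hx⟩ := poincare_miranda_fin (g := fun y j => g (fun i => y (e i)) (e.symm j))
    (by fun_prop)
    (fun y j hy => by
      have := abs_le.1 (h (fun i => y (e i)) (e.symm j))
      simp only [e.apply_symm_apply, hy, Icc.coe_zero] at this
      linarith [this.2])
    (fun y j hy => by
      have := abs_le.1 (h (fun i => y (e i)) (e.symm j))
      simp only [e.apply_symm_apply, hy, Icc.coe_one] at this
      linarith [this.1])
  refine ⟨fun i => x (e i), funext fun i => ?_⟩
  simpa using congrFun hx (e i)

/-! ### Covering dimension: Euclidean compacta and removal of zeros. -/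

/-- A compact space that maps continuously and injectively to a Euclidean space is finite
dimensional. -/
theorem CoveringDimLE.of_continuous_injective {C κ : Type*} [TopologicalSpace C] [CompactSpace C]
    [Fintype κ] {f : C → κ → ℝ} (hf : Continuous f) (hinj : Function.Injective f) :
    CoveringDimLE C (2 ^ Fintype.card κ) := by
  classical
  intro U _ hUo hUc
  have hemb : Topology.IsClosedEmbedding f := hf.isClosedEmbedding hinj
  obtain ⟨δ, hδ, hball⟩ := lebesgue_number_lemma_of_metric_sUnion (isCompact_range hf)
    (c := {W | IsOpen W ∧ ∃ u ∈ U, f ⁻¹' W ⊆ u}) (fun W hW => hW.1) (by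
      rintro _ ⟨x, rfl⟩
      obtain ⟨u, hu, hxu⟩ := hUc.ge (mem_univ x)
      obtain ⟨W, hW, rfl⟩ := hemb.isInducing.isOpen_iff.1 (hUo u hu)
      exact ⟨W, ⟨hW, _, hu, subset_rfl⟩, hxu⟩)
  obtain ⟨ε, hε, hεδ⟩ : ∃ ε > 0, ε + ε < δ := ⟨δ / 3, by positivity, by linarith⟩
  -- Overlapping boxes of side `2ε < δ` around lattice points: for each coordinate only two integers
  -- are possible at a given point, whence the crude bound `2 ^ card κ`.
  let box : (κ → ℤ) → Set C := fun z => {x | ∀ a, |f x a / ε - z a| < 1}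
  have hbox : ∀ z, IsOpen (box z) := fun z => by
    simp only [box, ofPred_forall]
    exact isOpen_iInter_of_finite fun a => isOpen_lt (by fun_prop) continuous_const
  have hself : ∀ x, x ∈ box fun a => ⌊f x a / ε⌋ := fun x a => by
    rw [abs_lt]
    constructor <;> linarith [Int.floor_le (f x a / ε), Int.lt_floor_add_one (f x a / ε)]
  obtain ⟨t, ht⟩ := isCompact_univ.elim_finite_subcover
    (fun x : C => box fun a => ⌊f x a / ε⌋) (fun x => hbox _)
    fun x _ => mem_iUnion.2 ⟨x, hself x⟩
  refine ⟨(fun x : C => box fun a => ⌊f x a / ε⌋) '' t, t.finite_toSet.image _, ?_, ?_, ?_, ?_⟩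
  · rintro _ ⟨x, -, rfl⟩
    exact hbox _
  · rw [sUnion_image]
    exact univ_subset_iff.1 ht
  · rintro _ ⟨x, -, rfl⟩
    obtain ⟨W, ⟨-, u, hu, hWu⟩, hxW⟩ := hball (f x) (mem_range_self x)
    refine ⟨u, hu, fun y hy => hWu (hxW ?_)⟩
    refine Metric.mem_ball.2 (lt_of_le_of_lt ((dist_pi_le_iff (by positivity)).2 fun a => ?_) hεδ)
    have h1 := abs_lt.1 (hself x a)
    have h2 := abs_lt.1 (hy a)
    have h3 : |f y a / ε - f x a / ε| ≤ 2 := by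
      rw [abs_le]
      constructor <;> linarith [h1.1, h1.2, h2.1, h2.2]
    rw [← sub_div, abs_div, abs_of_pos hε, div_le_iff₀ hε] at h3
    rw [Real.dist_eq]
    linarith
  · intro x
    have hsub : {v ∈ (fun x : C => box fun a => ⌊f x a / ε⌋) '' (t : Set C) | x ∈ v} ⊆
        (Fintype.piFinset fun a => {⌊f x a / ε⌋, ⌊f x a / ε⌋ + 1}).image box := by
      rintro _ ⟨⟨y, -, rfl⟩, hxy⟩
      refine Finset.mem_coe.2 (Finset.mem_image.2 ⟨_, Fintype.mem_piFinset.2 fun a => ?_, rfl⟩)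
      have h := abs_lt.1 (hxy a)
      have h1 : ⌊f x a / ε⌋ < ⌊f y a / ε⌋ + 1 := by
        rw [Int.floor_lt]; push_cast; linarith [h.2]
      have h2 : ⌊f y a / ε⌋ - 1 ≤ ⌊f x a / ε⌋ := by
        rw [Int.le_floor]; push_cast; linarith [h.1]
      rw [Finset.mem_insert, Finset.mem_singleton]
      omega
    refine (encard_le_encard hsub).trans ?_
    rw [encard_coe_eq_coe_finsetCard]
    refine le_trans (b := ((2 ^ Fintype.card κ : ℕ) : ℕ∞)) (Nat.cast_le.2 ?_) (by simp)
    refine Finset.card_image_le.trans ?_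
    rw [Fintype.card_piFinset]
    exact (Finset.prod_le_pow_card _ _ 2 fun a _ => Finset.card_le_two).trans (by simp)

/-- On a compact Hausdorff space of dimension at most `d`, every map to `ℝ ^ (d + 1)` can be
approximated by maps without zeros. -/
theorem CoveringDimLE.exists_approx_ne_zero {Y : Type*} [TopologicalSpace Y] [CompactSpace Y]
    [T2Space Y] {d : ℕ} (hd : CoveringDimLE Y d) (g : C(Y, Fin (d + 1) → ℝ)) {ε : ℝ}
    (hε : 0 < ε) : ∃ h : C(Y, Fin (d + 1) → ℝ), (∀ x, dist (h x) (g x) ≤ ε) ∧ ∀ x, h x ≠ 0 := by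
  classical
  obtain ⟨t, ht⟩ := isCompact_univ.elim_finite_subcover
    (fun y : Y => g ⁻¹' Metric.ball (g y) (ε / 2)) (fun y => Metric.isOpen_ball.preimage g.2)
    fun y _ => mem_iUnion.2 ⟨y, Metric.mem_ball_self (by positivity)⟩
  obtain ⟨V, hVf, hVo, hVc, hVU, hVd⟩ := hd
    ((fun y : Y => g ⁻¹' Metric.ball (g y) (ε / 2)) '' t) (t.finite_toSet.image _)
    (by rintro _ ⟨y, -, rfl⟩; exact Metric.isOpen_ball.preimage g.2)
    (by rw [sUnion_image]; exact univ_subset_iff.1 ht)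
  have : Finite V := hVf
  have : Fintype V := Fintype.ofFinite V
  have hy : ∀ v : V, ∃ y, ∀ x ∈ v.1, dist (g y) (g x) < ε / 2 := fun v => by
    obtain ⟨_, ⟨y, -, rfl⟩, hv⟩ := hVU v v.2
    exact ⟨y, fun x hx => by rw [dist_comm]; exact hv hx⟩
  choose y hy using hy
  obtain ⟨ρ, hρ⟩ := PartitionOfUnity.exists_isSubordinate_of_locallyFinite isClosed_univ
    (fun v : V => v.1) (fun v => hVo v v.2) (locallyFinite_of_finite _)
    (by rw [← sUnion_eq_iUnion, hVc])
  have hρV : ∀ v x, x ∉ v.1 → ρ v x = 0 := fun v x hx => by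
    by_contra h
    exact hx (hρ v (subset_closure h))
  have hρ1 : ∀ x, ∑ v, ρ v x = 1 := fun x => by
    rw [← finsum_eq_sum_of_fintype]; exact ρ.sum_eq_one (mem_univ x)
  let h₀ : C(Y, Fin (d + 1) → ℝ) := ⟨fun x => ∑ v, ρ v x • g (y v), by fun_prop⟩
  have hdist : ∀ x, dist (h₀ x) (g x) ≤ ε / 2 := fun x => by
    have := (convex_closedBall (g x) (ε / 2)).finsum_mem (w := fun v => ρ v x)
      (z := fun v => g (y v)) (fun v => ρ.nonneg v x) (ρ.sum_eq_one (mem_univ x))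
      fun v hv => (hy v x (by_contra fun h => hv (hρV v x h))).le
    rwa [finsum_eq_sum_of_fintype] at this
  -- Each value of `h₀` is a convex combination of at most `d + 1` points, hence lies in one of
  -- finitely many proper affine subspaces. Their union is null, so some small translation `w`
  -- avoids it.
  let P : Finset V → AffineSubspace ℝ (Fin (d + 1) → ℝ) := fun T =>
    affineSpan ℝ (T.image fun v => g (y v) : Finset (Fin (d + 1) → ℝ))
  have hspan : ∀ x, ∃ T : Finset V, T.card ≤ d + 1 ∧ h₀ x ∈ P T := fun x => by
    refine ⟨({v | ρ v x ≠ 0} : Finset V), ?_, ?_⟩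
    · have hsub : Subtype.val '' (({v | ρ v x ≠ 0} : Finset V) : Set V) ⊆ {v ∈ V | x ∈ v} := by
        rintro _ ⟨v, hv, rfl⟩
        simp only [Finset.coe_filter, Finset.mem_univ, true_and, mem_ofPred_eq] at hv
        exact ⟨v.2, by_contra fun h => hv (hρV v x h)⟩
      have := (encard_le_encard hsub).trans (hVd x)
      rw [Subtype.val_injective.encard_image, encard_coe_eq_coe_finsetCard] at this
      exact_mod_cast this
    · have hsum : h₀ x = ∑ v ∈ ({v | ρ v x ≠ 0} : Finset V), ρ v x • g (y v) := by
        rw [Finset.sum_filter]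
        exact Finset.sum_congr rfl fun v _ => by by_cases h : ρ v x = 0 <;> simp [h]
      rw [hsum]
      refine (P _).convex.sum_mem (fun v _ => ρ.nonneg v x) ?_ fun v hv => ?_
      · rw [Finset.sum_filter_ne_zero]; exact hρ1 x
      · exact subset_affineSpan ℝ _ (Finset.mem_coe.2 (Finset.mem_image_of_mem _ hv))
  have hnull : MeasureTheory.volume
      (⋃ T ∈ {T : Finset V | T.card ≤ d + 1}, (P T : Set (Fin (d + 1) → ℝ))) = 0 := by
    refine (MeasureTheory.measure_biUnion_null_iff (to_countable _)).2 fun T hT => ?_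
    refine MeasureTheory.Measure.addHaar_affineSubspace _ _ fun htop => ?_
    replace hT : T.card ≤ d + 1 := hT
    obtain hT0 | ⟨n, hn⟩ : T = ∅ ∨ ∃ n, T.card = n + 1 := by
      rcases T.eq_empty_or_nonempty with h | h
      · exact Or.inl h
      · exact Or.inr ⟨T.card - 1, by have := h.card_pos; omega⟩
    · simp [P, hT0] at htop
    · have h1 := finrank_vectorSpan_image_finset_le ℝ (fun v => g (y v)) T hn
      rw [← direction_affineSpan, show affineSpan ℝ _ = ⊤ from htop, AffineSubspace.direction_top,
        finrank_top, Module.finrank_fin_fun] at h1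
      omega
  obtain ⟨w, hw, hwP⟩ : ∃ w ∈ Metric.ball (0 : Fin (d + 1) → ℝ) (ε / 2),
      w ∉ ⋃ T ∈ {T : Finset V | T.card ≤ d + 1}, (P T : Set (Fin (d + 1) → ℝ)) := by
    by_contra! hsub
    exact (Metric.measure_ball_pos MeasureTheory.volume (0 : Fin (d + 1) → ℝ)
      (half_pos hε)).ne' (MeasureTheory.measure_mono_null hsub hnull)
  refine ⟨⟨fun x => h₀ x - w, by fun_prop⟩, fun x => ?_, fun x hx => ?_⟩
  · rw [mem_ball_zero_iff] at hw
    calc dist (h₀ x - w) (g x) ≤ dist (h₀ x - w) (h₀ x) + dist (h₀ x) (g x) := dist_triangle _ _ _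
      _ ≤ ε / 2 + ε / 2 := by
        gcongr
        · rw [dist_eq_norm]; simpa using hw.le
        · exact hdist x
      _ = ε := add_halves ε
  · obtain ⟨T, hT, hxT⟩ := hspan x
    refine hwP (mem_biUnion (show T ∈ {T : Finset V | T.card ≤ d + 1} from hT) ?_)
    rwa [← sub_eq_zero.1 hx]

/-- In a normal space, a map to `ℝ ^ (d + 1)` can be perturbed so as not to vanish on a given compact
set of dimension at most `d`. -/
theorem exists_perturbation_ne_zero {X : Type*} [TopologicalSpace X] [T2Space X] [NormalSpace X]
    {C : Set X} (hC : IsCompact C) {d : ℕ} (hd : CoveringDimLE C d) (g : Fin (d + 1) → C(X, ℝ))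
    {ε : ℝ} (hε : 0 < ε) : ∃ g' : Fin (d + 1) → C(X, ℝ),
      (∀ i x, |g' i x - g i x| ≤ ε) ∧ ∀ x ∈ C, ∃ i, g' i x ≠ 0 := by
  have : CompactSpace C := isCompact_iff_compactSpace.1 hC
  obtain ⟨h, hhg, hh0⟩ := hd.exists_approx_ne_zero
    ⟨fun x : C => fun i => g i x, by fun_prop⟩ hε
  obtain ⟨H, hH⟩ := ContinuousMap.exists_restrict_eq hC.isClosed h
  -- The Tietze extension is clamped to within `ε` of `g`; on `C` the clamping changes nothing.
  refine ⟨fun i => ⟨fun x => max (g i x - ε) (min (g i x + ε) (H x i)), by fun_prop⟩,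
    fun i x => ?_, fun x hx => ?_⟩
  · simp only [ContinuousMap.coe_mk]
    rw [abs_le]
    constructor
    · linarith [le_max_left (g i x - ε) (min (g i x + ε) (H x i))]
    · have : max (g i x - ε) (min (g i x + ε) (H x i)) ≤ g i x + ε :=
        max_le (by linarith) (min_le_left _ _)
      linarith
  · obtain ⟨i, hi⟩ := Function.ne_iff.1 (hh0 ⟨x, hx⟩)
    refine ⟨i, ?_⟩
    have hHx : H x = h ⟨x, hx⟩ := congrArg (fun k => k ⟨x, hx⟩) hH
    have := (dist_le_pi_dist _ _ i).trans (hhg ⟨x, hx⟩)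
    simp only [Real.dist_eq, ContinuousMap.coe_mk, abs_le] at this
    simp only [ContinuousMap.coe_mk, hHx]
    rw [min_eq_right (by linarith [this.2]), max_eq_right (by linarith [this.1])]
    exact hi

theorem finiteDimensionalSpace_of_subsingleton (X : Type*) [TopologicalSpace X] [Subsingleton X] :
    FiniteDimensionalSpace X :=
  ⟨_, CoveringDimLE.of_continuous_injective (κ := Fin 0) (f := fun _ => 0) continuous_const
    (Function.injective_of_subsingleton _)⟩

/-! ### Coordinates on Smirnov's compactum. -/

instance Sigma.instWeaklyLocallyCompactSpace {ι : Type*} {X : ι → Type*}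
    [∀ i, TopologicalSpace (X i)] [∀ i, CompactSpace (X i)] :
    WeaklyLocallyCompactSpace (Σ i, X i) where
  exists_compact_mem_nhds x := ⟨range (Sigma.mk x.1), isCompact_range continuous_sigmaMk,
    isOpen_range_sigmaMk.mem_nhds ⟨x.2, rfl⟩⟩

namespace SmirnovCompactum

/-- The point of `SmirnovCompactum` given by a point of the cube `I^k`. -/
def ofCube (k : ℕ+) (y : Fin (k : ℕ) → unitInterval) : SmirnovCompactum :=
  ((⟨k, y⟩ : Σ k : ℕ+, (Fin (k : ℕ) → unitInterval)) : SmirnovCompactum)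

theorem continuous_ofCube (k : ℕ+) : Continuous (ofCube k) :=
  OnePoint.continuous_coe.comp continuous_sigmaMk

/-- The dimension of the cube to which a point belongs; `0` for the point at infinity. -/
def cubeIndex : SmirnovCompactum → ℕ
  | none => 0
  | some p => p.1

/-- The `l`-th coordinate, increased by `1`, of the points of the cube `I^k`, and `0` elsewhere. -/
noncomputable def cubeCoord (k l : ℕ) : SmirnovCompactum → ℝ
  | none => 0
  | some p => if (p.1 : ℕ) = k then if h : l < p.1 then (p.2 ⟨l, h⟩ : ℝ) + 1 else 0 else 0

@[elab_as_elim]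
theorem cubeCases {p : SmirnovCompactum → Prop} (infty : p OnePoint.infty)
    (cube : ∀ k y, p (ofCube k y)) (x : SmirnovCompactum) : p x := by
  induction x using OnePoint.rec with
  | infty => exact infty
  | coe x => exact cube x.1 x.2

theorem cubeCoord_ofCube (k : ℕ+) (l : Fin (k : ℕ)) (y : Fin (k : ℕ) → unitInterval) :
    cubeCoord k l (ofCube k y) = y l + 1 :=
  (if_pos rfl).trans (dif_pos l.isLt)

theorem cubeCoord_of_ne {k l : ℕ} {x : SmirnovCompactum} (h : cubeIndex x ≠ k) :
    cubeCoord k l x = 0 := by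
  induction x using cubeCases with
  | infty => rfl
  | cube k' y => exact if_neg h

theorem isCompact_index_eq (k : ℕ) :
    IsCompact {p : Σ k : ℕ+, (Fin (k : ℕ) → unitInterval) | (p.1 : ℕ) = k} := by
  rcases k.eq_zero_or_pos with rfl | hk
  · convert isCompact_empty
    ext p
    simp
  · lift k to ℕ+ using hk
    convert isCompact_range (continuous_sigmaMk (σ := fun k : ℕ+ => Fin (k : ℕ) → unitInterval)
      (i := k))
    ext ⟨k', y⟩
    simp only [mem_ofPred_eq, PNat.coe_inj, mem_range]
    constructor
    · rintro rfl; exact ⟨y, rfl⟩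
    · rintro ⟨z, hz⟩; exact (congrArg Sigma.fst hz).symm

theorem isClopen_cubeIndex_eq {k : ℕ} (hk : k ≠ 0) : IsClopen {x | cubeIndex x = k} := by
  have hinf : OnePoint.infty ∉ {x | cubeIndex x = k} := fun h => hk (Eq.symm h)
  refine ⟨(OnePoint.isClosed_iff_of_notMem hinf).2 ⟨(isCompact_index_eq k).isClosed,
    isCompact_index_eq k⟩, (OnePoint.isOpen_iff_of_notMem hinf).2 ?_⟩
  refine isOpen_sigma_iff.2 fun k' => ?_
  exact isOpen_const (p := (k' : ℕ) = k)

theorem continuous_cubeCoord (k l : ℕ) : Continuous (cubeCoord k l) := by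
  refine (OnePoint.continuous_iff _).2 ⟨?_, ?_⟩
  · refine tendsto_const_nhds.congr' ?_
    have := (isCompact_index_eq k).compl_mem_cocompact
    rw [← Filter.coclosedCompact_eq_cocompact] at this
    filter_upwards [this] with p hp
    exact (cubeCoord_of_ne (x := (p : SmirnovCompactum)) hp).symm
  · refine continuous_sigma fun k' => ?_
    show Continuous fun y : Fin (k' : ℕ) → unitInterval =>
      if (k' : ℕ) = k then if h : l < k' then (y ⟨l, h⟩ : ℝ) + 1 else 0 else 0
    split_ifs <;> fun_prop

/-- Because of the shift by `1`, a nonzero value of `cubeCoord` also tells which cube contains the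
point. -/
theorem eq_of_cubeCoord_eq {m : ℕ} {x y : SmirnovCompactum} (hx : cubeIndex x ≤ m)
    (hy : cubeIndex y ≤ m)
    (h : ∀ k l : Fin m, cubeCoord (k + 1) l x = cubeCoord (k + 1) l y) : x = y := by
  have h' : ∀ (k : ℕ+) (l : Fin (k : ℕ)), (k : ℕ) ≤ m →
      cubeCoord k l x = cubeCoord k l y := fun k l hk => by
    have := h ⟨k - 1, by have := k.pos; omega⟩ ⟨l, by omega⟩
    rwa [show ((k : ℕ) - 1 + 1) = k from Nat.succ_pred k.ne_zero] at this
  have hpos : ∀ (k : ℕ+) (l : Fin (k : ℕ)) (z : Fin (k : ℕ) → unitInterval),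
      cubeCoord k l (ofCube k z) ≠ 0 := fun k l z => by
    rw [cubeCoord_ofCube]
    linarith [(z l).2.1]
  have hne : ∀ (k : ℕ+) (z : Fin (k : ℕ) → unitInterval) (w : SmirnovCompactum),
      (∀ l : Fin (k : ℕ), cubeCoord k l (ofCube k z) = cubeCoord k l w) → cubeIndex w = k := by
    intro k z w hw
    by_contra hwk
    exact hpos k ⟨0, k.pos⟩ z ((hw _).trans (cubeCoord_of_ne hwk))
  induction x using cubeCases with
  | infty =>
    induction y using cubeCases with
    | infty => rfl
    | cube k z => exact absurd (hne k z _ fun l => (h' k l hy).symm) k.ne_zero.symm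
  | cube k z =>
    induction y using cubeCases with
    | infty => exact absurd (hne k z _ fun l => h' k l hx) k.ne_zero.symm
    | cube k' z' =>
      obtain rfl : k' = k := PNat.coe_inj.1 (hne k z _ fun l => h' k l hx)
      congr 1
      ext l
      have := h' k' l hx
      rw [cubeCoord_ofCube, cubeCoord_ofCube] at this
      linarith

/-! ### Finite dimensional cores and their neighbourhoods. -/

variable {n : ℕ}

/-- The points of the power none of whose coordinates lies in a cube `I^k` with `a < k ≤ b`. -/
def avoiding (n a b : ℕ) : Set (Fin n → SmirnovCompactum) :=
  {x | ∀ i, cubeIndex (x i) ≤ a ∨ b < cubeIndex (x i)}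

/-- The points of the power all of whose coordinates are infinite or lie in a cube `I^k` with
`k ≤ a`. -/
def core (n a : ℕ) : Set (Fin n → SmirnovCompactum) :=
  {x | ∀ i, cubeIndex (x i) ≤ a}

theorem isClosed_avoiding (n a b : ℕ) : IsClosed (avoiding n a b) := by
  have : avoiding n a b = ⋂ (i : Fin n) (k ∈ Ioc a b),
      (fun x : Fin n → SmirnovCompactum => x i) ⁻¹' {x | cubeIndex x = k}ᶜ := by
    ext x
    simp only [avoiding, mem_ofPred_eq, mem_iInter, mem_Ioc, mem_preimage, mem_compl_iff]
    exact forall_congr' fun i => ⟨fun h k hk e => by omega,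
      fun h => by by_contra! hc; exact h _ hc rfl⟩
  rw [this]
  refine isClosed_iInter fun i => isClosed_biInter fun k hk => ?_
  exact (isClopen_cubeIndex_eq (Nat.ne_zero_of_lt hk.1)).compl.1.preimage (continuous_apply i)

theorem iInter_avoiding (n a : ℕ) : ⋂ b, avoiding n a b = core n a := by
  ext x
  simp only [avoiding, core, mem_iInter, mem_ofPred_eq]
  refine ⟨fun h i => (h (cubeIndex (x i)) i).resolve_right (lt_irrefl _), fun h b i => .inl (h i)⟩

theorem isClosed_core (n a : ℕ) : IsClosed (core n a) := by
  rw [← iInter_avoiding]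
  exact isClosed_iInter fun b => isClosed_avoiding n a b

/-- The coordinates of the cubes of dimension at most `a` embed the core in a Euclidean space. -/
theorem finiteDimensionalSpace_core (n a : ℕ) : FiniteDimensionalSpace (core n a) := by
  have : CompactSpace (core n a) := isCompact_iff_compactSpace.1 (isClosed_core n a).isCompact
  refine ⟨_, CoveringDimLE.of_continuous_injective
    (f := fun (x : core n a) (p : Fin n × Fin a × Fin a) => cubeCoord (p.2.1 + 1) p.2.2 (x.1 p.1))
    (continuous_pi fun p => (continuous_cubeCoord _ _).comp
      ((continuous_apply p.1).comp continuous_subtype_val)) fun x y hxy => ?_⟩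
  refine Subtype.ext (funext fun i => eq_of_cubeCoord_eq (x.2 i) (y.2 i) fun k l => ?_)
  exact congrFun hxy (i, k, l)

/-- The sets `avoiding n a b` are compact and decrease to the core as `b` grows. -/
theorem exists_avoiding_subset {a : ℕ} {B : Set (Fin n → SmirnovCompactum)} (hB : IsOpen B)
    (h : core n a ⊆ B) : ∃ b, a ≤ b ∧ avoiding n a b ⊆ B := by
  have hanti : ∀ {b c}, b ≤ c → avoiding n a c ⊆ avoiding n a b := fun hbc x hx i =>
    (hx i).imp_right hbc.trans_lt
  obtain ⟨b, hb⟩ := exists_subset_nhds_of_isCompact (V := fun b => avoiding n a b)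
    (fun b c => ⟨max b c, hanti (le_max_left _ _), hanti (le_max_right _ _)⟩)
    (fun b => (isClosed_avoiding n a b).isCompact)
    fun x hx => hB.mem_nhds (h (iInter_avoiding n a ▸ hx))
  exact ⟨max a b, le_max_left _ _, (hanti (le_max_right _ _)).trans hb⟩

/-! ### Thick sets. -/

/-- A set is `j`-thick if it contains the intersection, in a product of cubes of the first `j`
factors with the remaining space, of partitions between all the opposite faces of the cubes. -/
def Thick (j : ℕ) (E : Set (Fin n → SmirnovCompactum)) : Prop :=
  ∃ (k : Fin n → ℕ+) (g : Fin n → ℕ → C(Fin n → SmirnovCompactum, ℝ)),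
    (∀ i l x, |g i l x - (2 * cubeCoord (k i) l (x i) - 3)| ≤ 1 / 2) ∧
    ∀ x, (∀ i, i.val < j → cubeIndex (x i) = k i ∧ ∀ l < (k i : ℕ), g i l x = 0) → x ∈ E

theorem thick_zero_univ : Thick 0 (univ : Set (Fin n → SmirnovCompactum)) :=
  ⟨fun _ => 1, fun i l => ⟨fun x => 2 * cubeCoord 1 l (x i) - 3, by
    have := continuous_cubeCoord 1 l; fun_prop⟩, fun i l x => by simp, fun x _ => mem_univ x⟩

theorem Thick.nonempty {j : ℕ} {E : Set (Fin n → SmirnovCompactum)} (h : Thick j E) :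
    E.Nonempty := by
  obtain ⟨k, g, hg, hE⟩ := h
  -- On the product of the cubes `I^(k i)` over all `n` factors, `2 * cubeCoord - 3` becomes `2 y -
  -- 1`, so Poincaré–Miranda yields a common zero of all the `g i l`.
  let Φ : ((Σ i, Fin (k i : ℕ)) → unitInterval) → Fin n → SmirnovCompactum :=
    fun y i => ofCube (k i) fun l => y ⟨i, l⟩
  have hΦ : Continuous Φ := continuous_pi fun i => (continuous_ofCube (k i)).comp (by fun_prop)
  obtain ⟨y, hy⟩ := exists_eq_zero_of_abs_sub_le (g := fun y p => g p.1 p.2 (Φ y))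
    (by fun_prop) fun y p => by
      have := hg p.1 p.2 (Φ y)
      rw [cubeCoord_ofCube (k p.1) p.2] at this
      convert this using 2
      ring
  exact ⟨Φ y, hE _ fun i _ => ⟨rfl, fun l hl => congrFun hy ⟨i, l, hl⟩⟩⟩

/-- With `dim C ≤ d`, the cube `I^(d+1)` in the unused factor `j` has one coordinate too many for
`C`: the `d + 1` coordinate functions are perturbed off zero on `C`, and `F` is their common zero
set over that cube. -/
theorem Thick.exists_disjoint {j : ℕ} (hj : j < n) {E : Set (Fin n → SmirnovCompactum)}
    (h : Thick j E) {C : Set (Fin n → SmirnovCompactum)} (hC : IsCompact C)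
    (hCd : FiniteDimensionalSpace C) :
    ∃ F, IsClosed F ∧ Disjoint C F ∧ Thick (j + 1) (E ∩ F) := by
  obtain ⟨k, g, hg, hE⟩ := h
  obtain ⟨d, hd⟩ := hCd
  obtain ⟨f, hf, hfC⟩ := exists_perturbation_ne_zero hC hd
    (fun l : Fin (d + 1) => ⟨fun x => 2 * cubeCoord (d + 1) l (x ⟨j, hj⟩) - 3, by
      have := continuous_cubeCoord (d + 1) l; fun_prop⟩) (half_pos one_pos)
  refine ⟨{x | cubeIndex (x ⟨j, hj⟩) = d + 1 ∧ ∀ l, f l x = 0}, ?_, ?_, ?_⟩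
  · have h1 : IsClosed {x : Fin n → SmirnovCompactum | cubeIndex (x ⟨j, hj⟩) = d + 1} :=
      (isClopen_cubeIndex_eq d.succ_ne_zero).1.preimage
        (continuous_apply (A := fun _ => SmirnovCompactum) (⟨j, hj⟩ : Fin n))
    refine h1.inter (s₂ := {x | ∀ l, f l x = 0}) ?_
    rw [ofPred_forall]
    exact isClosed_iInter fun l => isClosed_eq (f l).2 continuous_const
  · refine disjoint_left.2 fun x hxC hx => ?_
    obtain ⟨l, hl⟩ := hfC x hxC
    exact hl (hx.2 l)
  -- For `l ≥ d + 1` the value is a filler that satisfies the estimate trivially.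
  · refine ⟨Function.update k ⟨j, hj⟩ d.succPNat, Function.update g ⟨j, hj⟩ fun l =>
      if hl : l < d + 1 then f ⟨l, hl⟩ else ⟨fun x => 2 * cubeCoord (d + 1) l (x ⟨j, hj⟩) - 3, by
      have := continuous_cubeCoord (d + 1) l; fun_prop⟩, fun i l x => ?_, fun x hx => ⟨?_, ?_⟩⟩
    · by_cases hi : i = ⟨j, hj⟩
      · subst hi
        simp only [Function.update_self, Nat.succPNat_coe]
        split_ifs with hl
        · exact hf ⟨l, hl⟩ x
        · simp
      · simp only [Function.update_of_ne hi]
        exact hg i l x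
    · refine hE x fun i hi => ?_
      have hi' : i ≠ ⟨j, hj⟩ := fun e => by simp [e] at hi
      simpa only [Function.update_of_ne hi'] using hx i (by omega)
    · have := hx ⟨j, hj⟩ (Nat.lt_succ_self j)
      simp only [Function.update_self, Nat.succPNat_coe] at this
      refine ⟨this.1, fun l => ?_⟩
      have h2 := this.2 l l.isLt
      rwa [dif_pos l.isLt] at h2

end SmirnovCompactum

/-! ### ONE defeats every strategy in at most `n` innings. -/

namespace SmirnovCompactum

variable {n : ℕ}

/-- ONE's move that preserves thickness of the part of `E` not covered by TWO's answer. -/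
def thickCover (j : ℕ) (E : Set (Fin n → SmirnovCompactum)) :
    Set (Set (Fin n → SmirnovCompactum)) :=
  {U | IsOpen U ∧ ∃ E' ⊆ E, Disjoint U E' ∧ Thick (j + 1) E'}

theorem thickCover_mem {j : ℕ} (hj : j < n) {E : Set (Fin n → SmirnovCompactum)} (h : Thick j E) :
    thickCover j E ∈ OkfdCovers (Fin n → SmirnovCompactum) := by
  have key : ∀ C : Set (Fin n → SmirnovCompactum), IsCompact C ∧ FiniteDimensionalSpace C →
      ∃ u ∈ thickCover j E, C ⊆ u := by
    rintro C ⟨hC, hCd⟩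
    obtain ⟨F, hF, hCF, hEF⟩ := h.exists_disjoint hj hC hCd
    exact ⟨Fᶜ, ⟨hF.isOpen_compl, E ∩ F, inter_subset_left,
      disjoint_compl_left.mono_right inter_subset_right, hEF⟩, hCF.subset_compl_right⟩
  refine ⟨fun u hu => hu.1, eq_univ_of_forall fun x => ?_, key⟩
  obtain ⟨u, hu, hxu⟩ := key {x} ⟨isCompact_singleton, finiteDimensionalSpace_of_subsingleton _⟩
  exact ⟨u, hu, hxu rfl⟩

theorem univ_mem_okfdCovers (X : Type*) [TopologicalSpace X] : {univ} ∈ OkfdCovers X :=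
  ⟨by simp, by simp, fun t _ => ⟨univ, rfl, subset_univ t⟩⟩

theorem not_twoHasWinningStrategy {m : ℕ} (hm : m ≤ n) :
    ¬ TwoHasWinningStrategy (OkfdCovers (Fin n → SmirnovCompactum))
      (OCovers (Fin n → SmirnovCompactum)) (m : Ordinal.{0}) := by
  rintro ⟨F, hF⟩
  -- ONE's play is built one inning at a time, with `{univ}` as a legal filler for later innings.
  -- Changing the move `j` does not affect TWO's answers before inning `j`.
  have key : ∀ j ≤ m, ∃ A : Ordinal.{0} → Set (Set (Fin n → SmirnovCompactum)),
      (∀ γ, A γ ∈ OkfdCovers (Fin n → SmirnovCompactum)) ∧ ∃ E, Thick j E ∧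
        ∀ γ < (j : Ordinal.{0}), Disjoint (F γ fun ξ => A ξ) E := by
    intro j hj
    induction j with
    | zero =>
      exact ⟨fun _ => {univ}, fun _ => univ_mem_okfdCovers _, univ, thick_zero_univ,
        fun γ hγ => absurd hγ (by simp)⟩
    | succ j ih =>
      obtain ⟨A, hA, E, hE, hAE⟩ := ih (by omega)
      let A' := Function.update A (j : Ordinal.{0}) (thickCover j E)
      have hA' : ∀ γ, A' γ ∈ OkfdCovers (Fin n → SmirnovCompactum) := fun γ => by
        by_cases h : γ = j
        · subst h; simpa [A'] using thickCover_mem (by omega) hE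
        · simpa [A', h] using hA γ
      obtain ⟨-, E', hE', hd, hthick⟩ : F j (fun ξ => A' ξ) ∈ thickCover j E := by
        have := (hF A' fun γ _ => hA' γ).1 j (by exact_mod_cast (by omega : j < m))
        simpa [A'] using this
      refine ⟨A', hA', E', hthick, fun γ hγ => ?_⟩
      rw [Nat.cast_succ, ← Order.succ_eq_add_one, Order.lt_succ_iff] at hγ
      rcases hγ.eq_or_lt with rfl | hγ
      · exact hd
      · have hres : (fun ξ : Iic γ => A' ξ) = fun ξ : Iic γ => A ξ := by
          funext ξ
          exact Function.update_of_ne (lt_of_le_of_lt ξ.2 hγ).ne _ _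
        rw [hres]
        exact (hAE γ hγ).mono_right hE'
  obtain ⟨A, hA, E, hE, hAE⟩ := key m le_rfl
  obtain ⟨x, hx⟩ := hE.nonempty
  obtain ⟨_, ⟨γ, hγ, rfl⟩, hxB⟩ := (hF A fun γ _ => hA γ).2.2.1.ge (mem_univ x)
  exact disjoint_left.1 (hAE γ hγ) hxB hx

/-! ### TWO wins in `n + 1` innings. -/

open Classical in
/-- A member of the cover `U` that contains the set `C`, if there is one. -/
noncomputable def memberContaining {X : Type*} (U : Set (Set X)) (C : Set X) : Set X :=
  if h : ∃ B ∈ U, C ⊆ B then h.choose else ∅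

theorem memberContaining_spec {X : Type*} {U : Set (Set X)} {C : Set X} (h : ∃ B ∈ U, C ⊆ B) :
    memberContaining U C ∈ U ∧ C ⊆ memberContaining U C := by
  rw [memberContaining, dif_pos h]
  exact h.choose_spec

open Classical in
/-- TWO's bookkeeping: before inning `j`, TWO takes care of the cubes of dimension at most
`bound A j`. -/
noncomputable def bound (A : ℕ → Set (Set (Fin n → SmirnovCompactum))) : ℕ → ℕ
  | 0 => 0
  | j + 1 =>
    if h : ∃ b, bound A j ≤ b ∧
        avoiding n (bound A j) b ⊆ memberContaining (A j) (core n (bound A j))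
    then h.choose else 0

/-- The bookkeeping uses past moves only, so it can be computed by a strategy. -/
theorem bound_congr {A A' : ℕ → Set (Set (Fin n → SmirnovCompactum))} {j : ℕ}
    (h : ∀ i < j, A i = A' i) : bound A j = bound A' j := by
  induction j with
  | zero => rfl
  | succ j ih =>
    simp only [bound]
    rw [ih fun i hi => h i (by omega), h j (by omega)]

theorem bound_spec {A : ℕ → Set (Set (Fin n → SmirnovCompactum))} {j : ℕ}
    (h : A j ∈ OkfdCovers (Fin n → SmirnovCompactum)) :
    memberContaining (A j) (core n (bound A j)) ∈ A j ∧ bound A j ≤ bound A (j + 1) ∧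
      avoiding n (bound A j) (bound A (j + 1)) ⊆
        memberContaining (A j) (core n (bound A j)) := by
  have h1 := memberContaining_spec (h.2.2 (core n (bound A j))
    ⟨(isClosed_core n _).isCompact, finiteDimensionalSpace_core n _⟩)
  have h2 := exists_avoiding_subset (h.1 _ h1.1) h1.2
  refine ⟨h1.1, ?_⟩
  rw [bound, dif_pos h2]
  exact h2.choose_spec

/-- Pigeonhole: the `n + 1` intervals `(b j, b (j + 1)]` are disjoint and there are `n` coordinates.
-/
theorem exists_forall_mem_avoiding {b : ℕ → ℕ} (hb : ∀ j < n + 1, b j ≤ b (j + 1))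
    (x : Fin n → SmirnovCompactum) : ∃ j < n + 1, x ∈ avoiding n (b j) (b (j + 1)) := by
  by_contra! h
  have h' : ∀ j : Fin (n + 1), ∃ i, b j < cubeIndex (x i) ∧ cubeIndex (x i) ≤ b (j + 1) := by
    intro j
    have := h j j.isLt
    simpa [avoiding] using this
  choose i hi using h'
  have hmono : ∀ {p q : ℕ}, p ≤ q → q ≤ n + 1 → b p ≤ b q := by
    intro p q hpq hq
    induction q, hpq using Nat.le_induction with
    | base => exact le_rfl
    | succ q _ ih => exact (ih (by omega)).trans (hb q (by omega))
  obtain ⟨p, q, hpq, he⟩ := Fintype.exists_ne_map_eq_of_card_lt i (by simp)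
  wlog hlt : p < q generalizing p q
  · exact this q p hpq.symm he.symm (lt_of_le_of_ne (not_lt.1 hlt) hpq.symm)
  have h1 := (hi p).2
  rw [he] at h1
  have h2 := hmono (p := p + 1) (q := q) hlt (by omega)
  exact (hi q).1.not_ge (h1.trans h2)

theorem twoHasWinningStrategy (n : ℕ) :
    TwoHasWinningStrategy (OkfdCovers (Fin n → SmirnovCompactum))
      (OCovers (Fin n → SmirnovCompactum)) ((n : Ordinal.{0}) + 1) := by
  let past : (γ : Ordinal.{0}) → (Iic γ → Set (Set (Fin n → SmirnovCompactum))) → ℕ →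
      Set (Set (Fin n → SmirnovCompactum)) :=
    fun γ a i => if h : (i : Ordinal.{0}) ≤ γ then a ⟨i, h⟩ else ∅
  let F : (γ : Ordinal.{0}) → (Iic γ → Set (Set (Fin n → SmirnovCompactum))) →
      Set (Fin n → SmirnovCompactum) := fun γ a =>
    -- Only finite `γ` matter, and for those `Cardinal.toNat γ.card` recovers the inning number.
    memberContaining (a ⟨γ, self_mem_Iic⟩) (core n (bound (past γ a) (Cardinal.toNat γ.card)))
  have hFnat : ∀ (A : Ordinal.{0} → Set (Set (Fin n → SmirnovCompactum))) (j : ℕ),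
      F j (fun ξ => A ξ) = memberContaining (A j) (core n (bound (fun i : ℕ => A i) j)) := by
    intro A j
    have : bound (past j fun ξ => A ξ) j = bound (fun i : ℕ => A i) j :=
      bound_congr fun i hi => dif_pos (by exact_mod_cast hi.le)
    simp [F, this]
  have hnat : ∀ γ : Ordinal.{0}, γ < n + 1 → ∃ j < n + 1, γ = ((j : ℕ) : Ordinal.{0}) := by
    intro γ hγ
    have hγ' : γ < ((n + 1 : ℕ) : Ordinal.{0}) := by exact_mod_cast hγ
    obtain ⟨j, rfl⟩ := Ordinal.lt_omega0.1 (hγ'.trans (Ordinal.natCast_lt_omega0 _))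
    exact ⟨j, by exact_mod_cast hγ', rfl⟩
  refine ⟨F, fun A hA => ?_⟩
  have hA' : ∀ j < n + 1, A ((j : ℕ) : Ordinal.{0}) ∈ OkfdCovers (Fin n → SmirnovCompactum) :=
    fun j hj => hA j (by exact_mod_cast hj)
  have hspec := fun j hj => bound_spec (A := fun i : ℕ => A i) (j := j) (hA' j hj)
  have hF : ∀ γ < (n : Ordinal.{0}) + 1, F γ (fun ξ => A ξ) ∈ A γ := by
    intro γ hγ
    obtain ⟨j, hj, rfl⟩ := hnat γ hγ
    rw [hFnat]
    exact (hspec j hj).1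
  have hcov : ∀ x, ∃ u ∈ {B | ∃ γ < (n : Ordinal.{0}) + 1, B = F γ fun ξ => A ξ}, x ∈ u := by
    intro x
    obtain ⟨j, hj, hx⟩ := exists_forall_mem_avoiding
      (b := bound fun i : ℕ => A i) (fun j hj => (hspec j hj).2.1) x
    refine ⟨_, ⟨j, by exact_mod_cast hj, rfl⟩, ?_⟩
    rw [hFnat]
    exact (hspec j hj).2.2 hx
  refine ⟨hF, ?_, eq_univ_of_forall hcov, ?_⟩
  · rintro _ ⟨γ, hγ, rfl⟩
    exact (hA γ hγ).1 _ (hF γ hγ)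
  · rintro _ ⟨x, rfl⟩
    obtain ⟨u, hu, hxu⟩ := hcov x
    exact ⟨u, hu, singleton_subset_iff.2 hxu⟩

/-! ### The exact length of the game. -/

theorem isLeast_twoHasWinningStrategy (n : ℕ) :
    IsLeast {α : Ordinal.{0} | TwoHasWinningStrategy (OkfdCovers (Fin n → SmirnovCompactum))
      (OCovers (Fin n → SmirnovCompactum)) α} ((n : Ordinal.{0}) + 1) := by
  refine ⟨twoHasWinningStrategy n, fun α hα => ?_⟩
  by_contra! hlt
  have hlt' : α < ((n + 1 : ℕ) : Ordinal.{0}) := by exact_mod_cast hlt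
  obtain ⟨j, rfl⟩ := Ordinal.lt_omega0.1 (hlt'.trans (Ordinal.natCast_lt_omega0 _))
  have hj : j < n + 1 := by exact_mod_cast hlt'
  exact not_twoHasWinningStrategy (Nat.lt_succ_iff.1 hj) hα

end SmirnovCompactum

theorem mainTheorem8 (n : ℕ) (hn : 1 ≤ n) :
    tp (OkfdCovers (Fin n → SmirnovCompactum)) (OCovers (Fin n → SmirnovCompactum)) =
      ((n : Ordinal.{0}) : WithBot Ordinal.{0}) ∧
    IsLeast {α : Ordinal.{0} | TwoHasWinningStrategy (OkfdCovers (Fin n → SmirnovCompactum))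
      (OCovers (Fin n → SmirnovCompactum)) α} ((n : Ordinal.{0}) + 1) := by
  have hleast := SmirnovCompactum.isLeast_twoHasWinningStrategy n
  -- `tp` counts `1 + α` innings, and ordinal addition cancels on the left.
  have hcomm : (n : Ordinal.{0}) + 1 = 1 + n := by exact_mod_cast Nat.add_comm n 1
  refine ⟨?_, hleast⟩
  rw [tp, if_neg (not_isEmpty_of_nonempty _), WithBot.coe_inj]
  refine IsLeast.csInf_eq ⟨?_, fun α hα => ?_⟩
  · rw [mem_ofPred_eq, ← hcomm]
    exact hleast.1
  · have := hleast.2 hα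
    rwa [hcomm, add_le_add_iff_left] at this
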